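/- A partial applicative system is a set $A$ with a partial binary operation (application) on it. A weak embedding of $\mathcal{A}$ into $\mathcal{B}$ is an injection $f : \mathcal{A} \to \mathcal{B}$ such that for all $a, b \in \mathcal{A}$, whenever $ab$ is defined in $\mathcal{A}$, $f(a)f(b)$ is defined in $\mathcal{B}$ and equals $f(ab)$. (It is not required to preserve the combinators $k$ and $s$.) Let $\mathcal{E}$ be the combinatory algebra of computably enumerable subsets of $\omega$, with the application of Scott's graph model, $$X \cdot Y = \{ n \in \omega \mid \exists u\, (\langle n, u\rangle \in X \wedge D_u \subseteq Y)\},$$ where $\langle\cdot,\cdot\rangle$ is a computable pairing bijection and $D_u$ is the finite set with canonical code $u$. Let $\mathcal{B}^{\mathrm{eff}}$ be the effective van Oosten model: its elements are the partial computable functions $f : \omega \rightharpoonup \omega$, with application $$f \cdot g = \Phi_{f(0)}^{f \oplus g},$$ where $(f\oplus g)(2n) \simeq f(n)$, $(f \oplus g)(2n+1) \simeq g(n)$, and $\Phi_e^{h}$ is the $e$-th partial computable function relative to the partial oracle $h$ in a standard numbering of oracle programs; a computation is undefined as soon as it queries $h$ outside its domain, and $f\cdot g$ is nowhere defined if $f(0)$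 is undefined. In both $\mathcal{E}$ and $\mathcal{B}^{\mathrm{eff}}$ application is total. **Theorem.** $\mathcal{E} \not\hookrightarrow \mathcal{B}^{\mathrm{eff}}$; that is, there is no weak embedding of $\mathcal{E}$ into $\mathcal{B}^{\mathrm{eff}}$. -/

import Mathlib

namespace PCA

/-! ### Partial applicative systems and weak embeddings -/

/-- A partial applicative system: a set with a partial binary application. -/
structure PartialApplicativeSystem where
  Carrier : Type
  app : Carrier → Carrier → Part Carrier

/-- A weak embedding is an injection `f` such that, whenever `a · b` is defined in `A`,
`f a · f b` is defined in `B` and equal to `f (a · b)`. -/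
def IsWeakEmbedding (A B : PartialApplicativeSystem) (f : A.Carrier → B.Carrier) : Prop :=
  Function.Injective f ∧
    ∀ a b c : A.Carrier, c ∈ A.app a b → f c ∈ B.app (f a) (f b)

def WeaklyEmbeds (A B : PartialApplicativeSystem) : Prop :=
  ∃ f : A.Carrier → B.Carrier, IsWeakEmbedding A B f

/-! ### Scott's graph model and the combinatory algebra of c.e. sets -/

/-- `D_u`, the finite set with canonical code `u`: `u` is the sum of `2 ^ i` over `i ∈ D_u`. -/
def canonicalFinset (u : ℕ) : Set ℕ := {i | Nat.testBit u i = true}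

/-- Application in the graph model, on arbitrary sets of natural numbers. -/
def graphApp (X Y : Set ℕ) : Set ℕ :=
  {n | ∃ u : ℕ, Nat.pair n u ∈ X ∧ canonicalFinset u ⊆ Y}

/-- Computably enumerable sets of natural numbers. -/
def IsCE (X : Set ℕ) : Prop := REPred fun n : ℕ => n ∈ X

theorem isCE_exists_code {X : Set ℕ} (hX : IsCE X) :
    ∃ c : Nat.Partrec.Code, ∀ n, n ∈ X ↔ ∃ k, (Nat.Partrec.Code.evaln k c n).isSome = true := by
  have h1 : Partrec fun n : ℕ => (Part.assert (n ∈ X) fun _ => Part.some ()).map fun _ => (0 : ℕ) :=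
    Partrec.map hX (Computable.const 0).to₂
  obtain ⟨c, hc⟩ := Nat.Partrec.Code.exists_code.1 (Partrec.nat_iff.1 h1)
  refine ⟨c, fun n => ?_⟩
  have h2 : n ∈ X ↔ ∃ x, x ∈ Nat.Partrec.Code.eval c n := by
    rw [hc]; simp
  rw [h2]
  constructor
  · rintro ⟨x, hx⟩
    obtain ⟨k, hk⟩ := Nat.Partrec.Code.evaln_complete.1 hx
    exact ⟨k, Option.isSome_iff_exists.2 ⟨x, hk⟩⟩
  · rintro ⟨k, hk⟩
    obtain ⟨x, hx⟩ := Option.isSome_iff_exists.1 hk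
    exact ⟨x, Nat.Partrec.Code.evaln_sound hx⟩

theorem isCE_of_computable_exists {X : Set ℕ} {p : ℕ → ℕ → Bool} (hp : Computable₂ p)
    (h : ∀ n, n ∈ X ↔ ∃ m, p n m = true) : IsCE X := by
  have h1 : Partrec fun n : ℕ => Nat.rfind fun m => Part.some (p n m) :=
    Partrec.rfind hp.partrec₂
  refine REPred.of_eq h1.dom_re fun n => ?_
  rw [h n]
  constructor
  · intro hd
    obtain ⟨m, hm⟩ := Part.dom_iff_mem.1 hd
    have h2 := Nat.rfind_spec hm
    exact ⟨m, (Part.mem_some_iff.1 h2).symm⟩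
  · rintro ⟨m, hm⟩
    exact Nat.rfind_dom.2 ⟨m, by rw [hm]; exact Part.mem_some _, fun _ => trivial⟩

/-- The c.e. sets are closed under application in the graph model. -/
theorem IsCE.graphApp {X Y : Set ℕ} (hX : IsCE X) (hY : IsCE Y) : IsCE (graphApp X Y) := by
  obtain ⟨c, hc⟩ := isCE_exists_code hX
  obtain ⟨d, hd⟩ := isCE_exists_code hY
  have hbit : Primrec₂ Nat.testBit := by
    have hpow : Primrec₂ fun u i : ℕ => decide (u / 2 ^ i % 2 = 1) := by
      have h2 : Primrec fun i : ℕ => 2 ^ i :=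
        (Primrec.nat_rec₁ 1 (Primrec.nat_mul.comp (Primrec.const 2) Primrec.snd).to₂).of_eq
          fun i => by
            induction i with
            | zero => rfl
            | succ i ih => rw [pow_succ, ← ih, mul_comm]
      exact (Primrec.eq.comp (Primrec.nat_mod.comp
        (Primrec.nat_div.comp Primrec.fst (h2.comp Primrec.snd)) (Primrec.const 2))
          (Primrec.const 1)).decide
    exact hpow.of_eq fun u i => by rw [Nat.testBit_eq_decide_div_mod_eq]
  have hrun : ∀ e : Nat.Partrec.Code,
      Primrec fun q : ℕ × ℕ => (Nat.Partrec.Code.evaln q.1 e q.2).isSome := fun e =>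
    Primrec.option_isSome.comp (Nat.Partrec.Code.primrec_evaln.comp
      (Primrec.pair (Primrec.pair Primrec.fst (Primrec.const e)) Primrec.snd))
  have hall : PrimrecRel fun (N : ℕ) (q : ℕ × ℕ) => ∀ i < N,
      (!Nat.testBit q.1 i || (Nat.Partrec.Code.evaln q.2 d i).isSome) = true := by
    have hR : PrimrecRel fun (i : ℕ) (q : ℕ × ℕ) =>
        (!Nat.testBit q.1 i || (Nat.Partrec.Code.evaln q.2 d i).isSome) = true :=
      Primrec.eq.comp (Primrec.or.comp (Primrec.not.comp
        (hbit.comp (Primrec.fst.comp Primrec.snd) Primrec.fst))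
        ((hrun d).comp (Primrec.pair (Primrec.snd.comp Primrec.snd) Primrec.fst)))
        (Primrec.const true)
    exact (hR.forall_mem_list.comp (Primrec.list_range.comp Primrec.fst) Primrec.snd).of_eq
      (by simp)
  have hu : Primrec fun q : ℕ × ℕ => q.2.unpair := Primrec.unpair.comp Primrec.snd
  have hp : PrimrecPred fun q : ℕ × ℕ =>
      (Nat.Partrec.Code.evaln q.2.unpair.2 c (Nat.pair q.1 q.2.unpair.1)).isSome = true ∧
      ∀ i < q.2.unpair.1, (!Nat.testBit q.2.unpair.1 i ||
        (Nat.Partrec.Code.evaln q.2.unpair.2 d i).isSome) = true := by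
    refine PrimrecPred.and ?_ (hall.comp (Primrec.fst.comp hu) hu)
    exact Primrec.eq.comp ((hrun c).comp (Primrec.pair (Primrec.snd.comp hu)
      (Primrec₂.natPair.comp Primrec.fst (Primrec.fst.comp hu)))) (Primrec.const true)
  refine isCE_of_computable_exists (p := fun n m => decide
    ((Nat.Partrec.Code.evaln m.unpair.2 c (Nat.pair n m.unpair.1)).isSome = true ∧
      ∀ i < m.unpair.1, (!Nat.testBit m.unpair.1 i ||
        (Nat.Partrec.Code.evaln m.unpair.2 d i).isSome) = true)) ?_ fun n => ?_
  · exact hp.decide.to_comp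
  have mono : ∀ {e : Nat.Partrec.Code} {k l x : ℕ}, k ≤ l →
      (Nat.Partrec.Code.evaln k e x).isSome = true →
      (Nat.Partrec.Code.evaln l e x).isSome = true := by
    intro e k l x hkl hx
    obtain ⟨y, hy⟩ := Option.isSome_iff_exists.1 hx
    exact Option.isSome_iff_exists.2 ⟨y, Nat.Partrec.Code.evaln_mono hkl hy⟩
  constructor
  · rintro ⟨u, hu, hD⟩
    obtain ⟨k, hk⟩ := (hc _).1 hu
    have hb : ∀ N : ℕ, ∃ l, ∀ i < N, Nat.testBit u i = true →
        (Nat.Partrec.Code.evaln l d i).isSome = true := by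
      intro N
      induction N with
      | zero => exact ⟨0, fun i hi => absurd hi (Nat.not_lt_zero i)⟩
      | succ N ih =>
        obtain ⟨l, hl⟩ := ih
        by_cases hN : Nat.testBit u N = true
        · obtain ⟨l', hl'⟩ := (hd N).1 (hD hN)
          refine ⟨max l l', fun i hi hiu => ?_⟩
          rcases Nat.lt_succ_iff_lt_or_eq.1 hi with h | rfl
          · exact mono (le_max_left _ _) (hl i h hiu)
          · exact mono (le_max_right _ _) hl'
        · refine ⟨l, fun i hi hiu => ?_⟩
          rcases Nat.lt_succ_iff_lt_or_eq.1 hi with h | rfl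
          · exact hl i h hiu
          · exact absurd hiu hN
    obtain ⟨l, hl⟩ := hb u
    refine ⟨Nat.pair u (max k l), ?_⟩
    rw [decide_eq_true_iff, Nat.unpair_pair]
    refine ⟨mono (le_max_left _ _) hk, fun i hi => ?_⟩
    cases hiu : Nat.testBit u i with
    | false => rfl
    | true => simpa using mono (le_max_right k l) (hl i hi hiu)
  · rintro ⟨m, hm⟩
    rw [decide_eq_true_iff] at hm
    refine ⟨m.unpair.1, (hc _).2 ⟨_, hm.1⟩, fun i hi => (hd i).2 ⟨m.unpair.2, ?_⟩⟩
    have hi' : Nat.testBit m.unpair.1 i = true := hi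
    have hlt : i < m.unpair.1 := lt_of_lt_of_le Nat.lt_two_pow_self (Nat.ge_two_pow_of_testBit hi')
    have := hm.2 i hlt
    rw [hi'] at this
    simpa using this

/-- The combinatory algebra `ℰ` of c.e. sets, a sub-algebra of the graph model. -/
def ceSets : PartialApplicativeSystem where
  Carrier := {X : Set ℕ // IsCE X}
  app X Y := Part.some ⟨graphApp X.1 Y.1, X.2.graphApp Y.2⟩

/-! ### Oracle computations -/

/-- Programs for computations with an oracle: the usual programs for partial recursive functions
together with an instruction that queries the oracle. -/
inductive OracleCode : Type
  | zero : OracleCode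
  | succ : OracleCode
  | left : OracleCode
  | right : OracleCode
  | oracle : OracleCode
  | pair : OracleCode → OracleCode → OracleCode
  | comp : OracleCode → OracleCode → OracleCode
  | prec : OracleCode → OracleCode → OracleCode
  | rfind : OracleCode → OracleCode

namespace OracleCode

/-- The partial function computed by a program with a partial oracle `h`. A computation that
queries `h` outside its domain is undefined. -/
def eval (h : ℕ →. ℕ) : OracleCode → ℕ →. ℕ
  | zero => fun _ => Part.some 0
  | succ => fun n => Part.some (n + 1)
  | left => fun n => Part.some n.unpair.1
  | right => fun n => Part.some n.unpair.2
  | oracle => h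
  | pair c d => fun n => (eval h c n).bind fun a => (eval h d n).map fun b => Nat.pair a b
  | comp c d => fun n => (eval h d n).bind (eval h c)
  | prec c d => fun p =>
      Nat.rec (eval h c p.unpair.1)
        (fun y IH => IH.bind fun i => eval h d (Nat.pair p.unpair.1 (Nat.pair y i))) p.unpair.2
  | rfind c => fun a =>
      Nat.rfind fun n => (eval h c (Nat.pair a n)).map fun m => decide (m = 0)

/-- The index of a program. -/
def toIndex : OracleCode → ℕ
  | zero => 0
  | succ => 1
  | left => 2
  | right => 3
  | oracle => 4
  | pair c d => 4 * Nat.pair (toIndex c) (toIndex d) + 5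
  | comp c d => 4 * Nat.pair (toIndex c) (toIndex d) + 6
  | prec c d => 4 * Nat.pair (toIndex c) (toIndex d) + 7
  | rfind c => 4 * toIndex c + 8

/-- The program with a given index. -/
def ofIndex : ℕ → OracleCode
  | 0 => zero
  | 1 => succ
  | 2 => left
  | 3 => right
  | 4 => oracle
  | n + 5 =>
    have h : n / 4 < n + 5 := by omega
    have h₁ : (n / 4).unpair.1 < n + 5 := lt_of_le_of_lt (n / 4).unpair_left_le h
    have h₂ : (n / 4).unpair.2 < n + 5 := lt_of_le_of_lt (n / 4).unpair_right_le h
    match n % 4 with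
    | 0 => pair (ofIndex (n / 4).unpair.1) (ofIndex (n / 4).unpair.2)
    | 1 => comp (ofIndex (n / 4).unpair.1) (ofIndex (n / 4).unpair.2)
    | 2 => prec (ofIndex (n / 4).unpair.1) (ofIndex (n / 4).unpair.2)
    | _ => rfind (ofIndex (n / 4))

theorem ofIndex_toIndex (c : OracleCode) : ofIndex (toIndex c) = c := by
  induction c with
  | zero | succ | left | right | oracle => simp [toIndex, ofIndex]
  | pair c d hc hd =>
    have h1 : (4 * Nat.pair (toIndex c) (toIndex d)) / 4 = Nat.pair (toIndex c) (toIndex d) := by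
      omega
    have h2 : (4 * Nat.pair (toIndex c) (toIndex d)) % 4 = 0 := by omega
    rw [toIndex, ofIndex]
    simp [hc, hd]
  | comp c d hc hd =>
    have h1 : (4 * Nat.pair (toIndex c) (toIndex d) + 1) / 4 =
      Nat.pair (toIndex c) (toIndex d) := by omega
    have h2 : (4 * Nat.pair (toIndex c) (toIndex d) + 1) % 4 = 1 := by omega
    rw [toIndex, ofIndex]
    simp [h1, h2, hc, hd]
  | prec c d hc hd =>
    have h1 : (4 * Nat.pair (toIndex c) (toIndex d) + 2) / 4 =
      Nat.pair (toIndex c) (toIndex d) := by omega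
    have h2 : (4 * Nat.pair (toIndex c) (toIndex d) + 2) % 4 = 2 := by omega
    rw [toIndex, ofIndex]
    simp [h1, h2, hc, hd]
  | rfind c hc =>
    have h1 : (4 * toIndex c + 3) / 4 = toIndex c := by omega
    have h2 : (4 * toIndex c + 3) % 4 = 3 := by omega
    rw [toIndex, ofIndex]
    simp [h1, h2, hc]

theorem toIndex_ofIndex (n : ℕ) : toIndex (ofIndex n) = n := by
  induction n using Nat.strong_induction_on with
  | _ n ih =>
    match n with
    | 0 | 1 | 2 | 3 | 4 => simp [toIndex, ofIndex]
    | n + 5 =>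
      have h : n / 4 < n + 5 := by omega
      have h₀ := ih _ h
      have h₁ := ih _ (lt_of_le_of_lt (n / 4).unpair_left_le h)
      have h₂ := ih _ (lt_of_le_of_lt (n / 4).unpair_right_le h)
      have h3 : n % 4 = 0 ∨ n % 4 = 1 ∨ n % 4 = 2 ∨ n % 4 = 3 := by omega
      rw [ofIndex]
      rcases h3 with h3 | h3 | h3 | h3 <;> simp [h3, toIndex, h₀, h₁, h₂] <;> omega

/-- A program with a partial recursive oracle computes a partial recursive function. -/
theorem eval_partrec {h : ℕ →. ℕ} (hh : Nat.Partrec h) (c : OracleCode) :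
    Nat.Partrec (eval h c) := by
  induction c with
  | zero => exact Nat.Partrec.zero
  | succ => exact Nat.Partrec.succ
  | left => exact Nat.Partrec.left
  | right => exact Nat.Partrec.right
  | oracle => exact hh
  | pair c d hc hd =>
    refine (Nat.Partrec.pair hc hd).of_eq fun n => ?_
    simp [eval, Seq.seq, Part.bind_map]
  | comp c d hc hd => exact Nat.Partrec.comp hc hd
  | prec c d hc hd => exact Nat.Partrec.prec hc hd
  | rfind c hc => exact Nat.Partrec.rfind hc

end OracleCode

/-- `Φ e h`, the `e`-th partial computable function relative to the partial oracle `h`. -/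
def Φ (e : ℕ) (h : ℕ →. ℕ) : ℕ →. ℕ := (OracleCode.ofIndex e).eval h

/-! ### The van Oosten model and its effective version -/

/-- The join `f ⊕ g`, with `(f ⊕ g)(2n) ≃ f(n)` and `(f ⊕ g)(2n+1) ≃ g(n)`. -/
def join (f g : ℕ →. ℕ) : ℕ →. ℕ := fun n => if n % 2 = 0 then f (n / 2) else g (n / 2)

/-- Application in the van Oosten model, on arbitrary partial functions:
`f · g = Φ_{f(0)}^{f ⊕ g}`, which is nowhere defined if `f(0)` is undefined. -/
def oostenApp (f g : ℕ →. ℕ) : ℕ →. ℕ := fun n => (f 0).bind fun e => Φ e (join f g) n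

theorem join_partrec {f g : ℕ →. ℕ} (hf : Nat.Partrec f) (hg : Nat.Partrec g) :
    Nat.Partrec (join f g) := by
  have hd : Computable fun n : ℕ => n / 2 :=
    (Primrec.nat_div.comp Primrec.id (Primrec.const 2)).to_comp
  have hm : Computable fun n : ℕ => decide (n % 2 = 0) :=
    (Primrec.eq.comp (Primrec.nat_mod.comp Primrec.id (Primrec.const 2))
      (Primrec.const 0)).decide.to_comp
  refine Partrec.nat_iff.1 ((Partrec.cond hm ((Partrec.nat_iff.2 hf).comp hd)
    ((Partrec.nat_iff.2 hg).comp hd)).of_eq fun n => ?_)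
  by_cases hn : n % 2 = 0 <;> simp [join, hn]

theorem oostenApp_partrec {f g : ℕ →. ℕ} (hf : Nat.Partrec f) (hg : Nat.Partrec g) :
    Nat.Partrec (oostenApp f g) := by
  rcases Part.eq_none_or_eq_some (f 0) with h | ⟨e, h⟩
  · exact Nat.Partrec.none.of_eq fun n => by simp [oostenApp, h]
  · exact ((OracleCode.ofIndex e).eval_partrec (join_partrec hf hg)).of_eq fun n => by
      simp [oostenApp, h, Φ]

/-- The effective van Oosten model: the partial computable functions, with application as in the
van Oosten model. -/
def oostenEff : PartialApplicativeSystem where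
  Carrier := {f : ℕ →. ℕ // Nat.Partrec f}
  app f g := Part.some ⟨oostenApp f.1 g.1, oostenApp_partrec f.2 g.2⟩

end PCA

namespace PCA

open Nat.Partrec (Code)

/-! ### Computably enumerable sets -/

/-! The graph model contains a parallel disjunction, while oracle computations are sequential; the
obstruction is that the latter are stable. Let `f` be a weak embedding.

Its values are first shown to be monotone. If `X ⊆ Y` but some value `y` of `f X` at `m` were lost
in `f Y`, take a c.e. `Q` with `Q · {n} = Y` for `n` in the halting set and `Q · {n} = X` otherwise
(`switchGraph`). Nothing says that `f` is computable, but `{n + 1} = S · {n}` for a fixed `S`, so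
the functions `f {n}` are uniformly computable. Then "`f Q · f {n}` takes the value `y` at `m`" is a
c.e. condition on `n` defining the complement of the halting set, which is absurd
(`IsWeakEmbedding.mono`).

Now let `A = {⟨0,1⟩} ⊆ B = {⟨0,0⟩, ⟨0,1⟩}`, the values of parallel disjunction at `∅` and `{0}`.
Then `B · ∅ = A · {0} = {0}` and `A · ∅ = ∅`. By monotonicity, stability applies to the images
(`oostenApp_stable`): whatever both `f B · f ∅` and `f A · f {0}` compute, `f A · f ∅` computes too.
So `f {0}` is contained in `f ∅`, hence equal to it, against injectivity. -/

theorem IsCE.exists_computable {X : Set ℕ} (hX : IsCE X) :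
    ∃ p : ℕ → ℕ → Bool, Computable₂ p ∧ ∀ n, n ∈ X ↔ ∃ m, p n m = true := by
  obtain ⟨c, hc⟩ := isCE_exists_code hX
  refine ⟨fun n k => (Code.evaln k c n).isSome, ?_, hc⟩
  exact (Primrec.option_isSome.comp (Code.primrec_evaln.comp
    (Primrec.pair (Primrec.pair Primrec.snd (Primrec.const c)) Primrec.fst))).to_comp

theorem isCE_of_primrecPred {X : Set ℕ} (hX : PrimrecPred fun n => n ∈ X) : IsCE X :=
  hX.computablePred.to_re

theorem isCE_empty : IsCE ∅ :=
  isCE_of_primrecPred ((PrimrecPred.of_eq (p := fun _ : ℕ => (0 : ℕ) = 1)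
    (Primrec.eq.comp (Primrec.const 0) (Primrec.const 1))) (by simp))

theorem isCE_singleton (a : ℕ) : IsCE {a} :=
  isCE_of_primrecPred (Primrec.eq.comp Primrec.id (Primrec.const a))

theorem isCE_pair (a b : ℕ) : IsCE {a, b} :=
  isCE_of_primrecPred ((Primrec.eq.comp Primrec.id (Primrec.const a)).or
    (Primrec.eq.comp Primrec.id (Primrec.const b)))

theorem primrec_two_pow : Primrec fun i : ℕ => 2 ^ i :=
  (Primrec.nat_rec₁ 1 (Primrec.nat_mul.comp (Primrec.const 2) Primrec.snd).to₂).of_eq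
    fun i => by
      induction i with
      | zero => rfl
      | succ i ih => rw [pow_succ, ← ih, mul_comm]

@[simp] theorem canonicalFinset_zero : canonicalFinset 0 = ∅ := by
  simp [canonicalFinset]

@[simp] theorem canonicalFinset_two_pow (n : ℕ) : canonicalFinset (2 ^ n) = {n} := by
  ext i
  simp [canonicalFinset, Nat.testBit_two_pow, eq_comm]

@[simp] theorem canonicalFinset_one : canonicalFinset 1 = {0} :=
  canonicalFinset_two_pow 0

/-! ### Particular elements of the graph model -/

/-- The element of the graph model sending `{n}` to `{n + 1}`. -/
def successorGraph : Set ℕ := {p | ∃ n, p = Nat.pair (n + 1) (2 ^ n)}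

theorem isCE_successorGraph : IsCE successorGraph := by
  refine isCE_of_computable_exists
    (p := fun p n => decide (p = Nat.pair (n + 1) (2 ^ n))) ?_ (by simp [successorGraph])
  exact (Primrec.eq.comp Primrec.fst (Primrec₂.natPair.comp (Primrec.succ.comp Primrec.snd)
    (primrec_two_pow.comp Primrec.snd))).decide.to_comp

theorem graphApp_successorGraph (n : ℕ) : graphApp successorGraph {n} = {n + 1} := by
  ext a
  simp [graphApp, successorGraph, Nat.pair_eq_pair]

/-- The element of the graph model sending `Z` to `X`, joined with `Y` if `Z` meets `K`. -/
def switchGraph (K X Y : Set ℕ) : Set ℕ :=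
  {p | p.unpair.1 ∈ X ∨ (p.unpair.1 ∈ Y ∧ ∃ n ∈ K, p.unpair.2 = 2 ^ n)}

theorem IsCE.switchGraph {K X Y : Set ℕ} (hK : IsCE K) (hX : IsCE X) (hY : IsCE Y) :
    IsCE (switchGraph K X Y) := by
  obtain ⟨p, hp, hpX⟩ := hX.exists_computable
  obtain ⟨q, hq, hqY⟩ := hY.exists_computable
  obtain ⟨r, hr, hrK⟩ := hK.exists_computable
  -- In the second alternative `m` codes `⟨k, ⟨n, l⟩⟩`: a witness `k` for membership in `Y`, the
  -- element `n` of `K`, and a witness `l` for `n ∈ K`.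
  refine isCE_of_computable_exists (p := fun a m => p a.unpair.1 m ||
    (q a.unpair.1 m.unpair.1 && (decide (a.unpair.2 = 2 ^ m.unpair.2.unpair.1) &&
      r m.unpair.2.unpair.1 m.unpair.2.unpair.2))) ?_ fun a => ?_
  · have ha : Computable fun z : ℕ × ℕ => z.1.unpair := Computable.unpair.comp Computable.fst
    have hm : Computable fun z : ℕ × ℕ => z.2.unpair := Computable.unpair.comp Computable.snd
    have hm' : Computable fun z : ℕ × ℕ => z.2.unpair.2.unpair :=
      Computable.unpair.comp (Computable.snd.comp hm)
    have heq : Computable₂ fun a b : ℕ => decide (a = b) := Primrec.eq.decide.to_comp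
    exact Primrec.or.to_comp.comp (hp.comp (Computable.fst.comp ha) Computable.snd)
      (Primrec.and.to_comp.comp (hq.comp (Computable.fst.comp ha) (Computable.fst.comp hm))
        (Primrec.and.to_comp.comp
          (heq.comp (Computable.snd.comp ha)
            (primrec_two_pow.to_comp.comp (Computable.fst.comp hm')))
          (hr.comp (Computable.fst.comp hm') (Computable.snd.comp hm'))))
  · simp only [PCA.switchGraph, Set.mem_ofPred_eq, Bool.or_eq_true, Bool.and_eq_true,
      decide_eq_true_eq, hpX, hqY, hrK]
    constructor
    · rintro (⟨m, hm⟩ | ⟨⟨k, hk⟩, n, ⟨l, hl⟩, hn⟩)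
      · exact ⟨m, .inl hm⟩
      · exact ⟨Nat.pair k (Nat.pair n l), .inr (by simpa using ⟨hk, hn, hl⟩)⟩
    · rintro ⟨m, hm | ⟨hk, hn, hl⟩⟩
      · exact .inl ⟨m, hm⟩
      · exact .inr ⟨⟨_, hk⟩, _, ⟨_, hl⟩, hn⟩

/-- Both kinds of pairs fire, which gives `X ∪ Y`; the inclusion makes this `Y`. -/
theorem graphApp_switchGraph_of_mem {K X Y : Set ℕ} (hXY : X ⊆ Y) {n : ℕ} (hn : n ∈ K) :
    graphApp (switchGraph K X Y) {n} = Y := by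
  ext a
  simp only [graphApp, switchGraph, Set.mem_ofPred_eq, Nat.unpair_pair]
  constructor
  · rintro ⟨u, h | h, -⟩
    exacts [hXY h, h.1]
  · exact fun h => ⟨2 ^ n, .inr ⟨h, n, hn, rfl⟩, by simp⟩

/-- A conditional pair needs `{k} ⊆ {n}` with `k ∈ K`, hence `k = n`, so none of them fires. -/
theorem graphApp_switchGraph_of_notMem {K X Y : Set ℕ} {n : ℕ} (hn : n ∉ K) :
    graphApp (switchGraph K X Y) {n} = X := by
  ext a
  simp only [graphApp, switchGraph, Set.mem_ofPred_eq, Nat.unpair_pair]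
  constructor
  · rintro ⟨u, h | ⟨-, k, hk, rfl⟩, hu⟩
    · exact h
    · simp only [canonicalFinset_two_pow, Set.singleton_subset_singleton] at hu
      exact absurd (hu ▸ hk) hn
  · exact fun h => ⟨0, .inl h, by simp⟩

/-- A curried parallel disjunction: applied to `X` and then to `Y` it gives `{0}` if `0 ∈ X` or
`0 ∈ Y`, and `∅` otherwise. -/
def parallelOr : Set ℕ := {Nat.pair (Nat.pair 0 0) 1, Nat.pair (Nat.pair 0 1) 0}

theorem graphApp_parallelOr_empty : graphApp parallelOr ∅ = {Nat.pair 0 1} := by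
  ext a
  simp only [graphApp, parallelOr, Set.mem_ofPred_eq, Set.mem_insert_iff, Set.mem_singleton_iff,
    Nat.pair_eq_pair]
  constructor
  · rintro ⟨u, ⟨-, rfl⟩ | ⟨h, -⟩, hu⟩
    · simp at hu
    · exact h
  · exact fun h => ⟨0, .inr ⟨h, rfl⟩, by simp⟩

theorem graphApp_parallelOr_zero :
    graphApp parallelOr {0} = {Nat.pair 0 0, Nat.pair 0 1} := by
  ext a
  simp only [graphApp, parallelOr, Set.mem_ofPred_eq, Set.mem_insert_iff, Set.mem_singleton_iff,
    Nat.pair_eq_pair]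
  constructor
  · rintro ⟨u, ⟨h, -⟩ | ⟨h, -⟩, -⟩
    exacts [.inl h, .inr h]
  · rintro (h | h)
    · exact ⟨1, .inl ⟨h, rfl⟩, by simp⟩
    · exact ⟨0, .inr ⟨h, rfl⟩, by simp⟩

theorem graphApp_pair_zero_one_empty : graphApp {Nat.pair 0 1} ∅ = ∅ := by
  ext a
  simp only [graphApp, Set.mem_ofPred_eq, Set.mem_singleton_iff, Nat.pair_eq_pair,
    Set.mem_empty_iff_false, iff_false]
  rintro ⟨u, ⟨-, rfl⟩, hu⟩
  simp at hu

theorem graphApp_pair_zero_one_zero : graphApp {Nat.pair 0 1} {0} = {0} := by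
  ext a
  simp only [graphApp, Set.mem_ofPred_eq, Set.mem_singleton_iff, Nat.pair_eq_pair]
  exact ⟨fun ⟨_, h, _⟩ => h.1, fun h => ⟨1, ⟨h, rfl⟩, by simp⟩⟩

theorem graphApp_pair_zero_zero_empty :
    graphApp {Nat.pair 0 0, Nat.pair 0 1} ∅ = {0} := by
  ext a
  simp only [graphApp, Set.mem_ofPred_eq, Set.mem_insert_iff, Set.mem_singleton_iff,
    Nat.pair_eq_pair]
  constructor
  · rintro ⟨u, h | h, -⟩ <;> exact h.1
  · exact fun h => ⟨0, .inl ⟨h, rfl⟩, by simp⟩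

/-! ### Stability and uniform computability of oracle computations -/

namespace OracleCode

/-- Oracle computations are stable: computations converging on two oracles already converge, to the
same value, on any oracle that contains everything defined in both. -/
theorem eval_stable {h h₁ h₂ : ℕ →. ℕ}
    (H : ∀ q y z, y ∈ h₁ q → z ∈ h₂ q → y ∈ h q ∧ y = z) (c : OracleCode) :
    ∀ x y z, y ∈ eval h₁ c x → z ∈ eval h₂ c x → y ∈ eval h c x ∧ y = z := by
  induction c with
  | zero | succ | left | right =>
    intro x y z hy hz
    simp only [eval, Part.mem_some_iff] at hy hz ⊢
    exact ⟨hy, hy.trans hz.symm⟩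
  | oracle => exact H
  | pair c d hc hd =>
    intro x y z hy hz
    simp only [eval, Part.mem_bind_iff, Part.mem_map_iff] at hy hz ⊢
    obtain ⟨a, ha, b, hb, rfl⟩ := hy
    obtain ⟨a', ha', b', hb', rfl⟩ := hz
    obtain ⟨ha, rfl⟩ := hc _ _ _ ha ha'
    obtain ⟨hb, rfl⟩ := hd _ _ _ hb hb'
    exact ⟨⟨a, ha, b, hb, rfl⟩, rfl⟩
  | comp c d hc hd =>
    intro x y z hy hz
    obtain ⟨a, ha, hy⟩ := Part.mem_bind_iff.1 hy
    obtain ⟨a', ha', hz⟩ := Part.mem_bind_iff.1 hz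
    obtain ⟨ha, rfl⟩ := hd _ _ _ ha ha'
    obtain ⟨hy, rfl⟩ := hc _ _ _ hy hz
    exact ⟨Part.mem_bind_iff.2 ⟨a, ha, hy⟩, rfl⟩
  | prec c d hc hd =>
    intro x
    simp only [eval]
    induction x.unpair.2 with
    | zero => exact hc _
    | succ n ih =>
      intro y z hy hz
      simp only [Part.mem_bind_iff] at hy hz ⊢
      obtain ⟨a, ha, hy⟩ := hy
      obtain ⟨a', ha', hz⟩ := hz
      obtain ⟨ha, rfl⟩ := ih _ _ ha ha'
      obtain ⟨hy, rfl⟩ := hd _ _ _ hy hz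
      exact ⟨⟨a, ha, hy⟩, rfl⟩
  | rfind c hc =>
    have hc' : ∀ (x : ℕ) (b b' : Bool),
        b ∈ (eval h₁ c x).map (fun m => decide (m = 0)) →
        b' ∈ (eval h₂ c x).map (fun m => decide (m = 0)) →
        b ∈ (eval h c x).map (fun m => decide (m = 0)) ∧ b = b' := by
      intro x b b' hb hb'
      rw [Part.mem_map_iff] at hb hb' ⊢
      obtain ⟨a, ha, rfl⟩ := hb
      obtain ⟨a', ha', rfl⟩ := hb'
      obtain ⟨ha, rfl⟩ := hc _ _ _ ha ha'
      exact ⟨⟨a, ha, rfl⟩, rfl⟩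
    intro x y z hy hz
    replace hy := Nat.mem_rfind.1 hy
    replace hz := Nat.mem_rfind.1 hz
    -- At the smaller of two distinct results, one search would see zero and the other a nonzero
    -- value.
    have hyz : y = z := by
      rcases lt_trichotomy y z with hlt | heq | hlt
      · exact absurd (hc' _ _ _ hy.1 (hz.2 hlt)).2 (by simp)
      · exact heq
      · exact absurd (hc' _ _ _ (hy.2 hlt) hz.1).2 (by simp)
    subst hyz
    exact ⟨Nat.mem_rfind.2
      ⟨(hc' _ _ _ hy.1 hz.1).1, fun hm => (hc' _ _ _ (hy.2 hm) (hz.2 hm)).1⟩, rfl⟩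

/-- Oracle computations are partial recursive uniformly in the oracle. -/
theorem eval_partrec₂ {α : Type*} [Primcodable α] {h : α → ℕ →. ℕ} (hh : Partrec₂ h)
    (c : OracleCode) : Partrec₂ fun a => eval (h a) c := by
  induction c with
  | zero => exact (Computable.const 0).partrec
  | succ => exact (Computable.succ.comp Computable.snd).partrec
  | left => exact (Computable.fst.comp (Computable.unpair.comp Computable.snd)).partrec
  | right => exact (Computable.snd.comp (Computable.unpair.comp Computable.snd)).partrec
  | oracle => exact hh
  | pair c d hc hd =>
    refine Partrec.bind hc (Partrec.map (hd.comp (Computable.fst.comp Computable.fst)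
      (Computable.snd.comp Computable.fst)) ?_)
    exact (Primrec₂.natPair.comp (Primrec.snd.comp Primrec.fst) Primrec.snd).to_comp
  | comp c d hc hd =>
    exact Partrec.bind hd (hc.comp (Computable.fst.comp Computable.fst) Computable.snd)
  | prec c d hc hd =>
    have hu : Computable fun z : α × ℕ => z.2.unpair := Computable.unpair.comp Computable.snd
    refine Partrec.nat_rec (Computable.snd.comp hu)
      (hc.comp Computable.fst (Computable.fst.comp hu)) (h := fun z w =>
        eval (h z.1) d (Nat.pair z.2.unpair.1 (Nat.pair w.1 w.2))) ?_
    refine hd.comp (Computable.fst.comp Computable.fst) ?_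
    exact Primrec₂.natPair.to_comp.comp (Computable.fst.comp (hu.comp Computable.fst))
      (Primrec₂.natPair.to_comp.comp (Computable.fst.comp Computable.snd)
        (Computable.snd.comp Computable.snd))
  | rfind c hc =>
    refine Partrec.rfind (p := fun (z : α × ℕ) n =>
      (eval (h z.1) c (Nat.pair z.2 n)).map fun m => decide (m = 0)) ?_
    refine Partrec.map (hc.comp (Computable.fst.comp Computable.fst)
      (Primrec₂.natPair.to_comp.comp (Computable.snd.comp Computable.fst) Computable.snd)) ?_
    exact (Primrec.eq.comp Primrec.snd (Primrec.const 0)).decide.to_comp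

end OracleCode

/-! ### Uniform computability of application -/

theorem join_partrec₂ {α : Type*} [Primcodable α] {f : ℕ →. ℕ} {g : α → ℕ →. ℕ}
    (hf : Nat.Partrec f) (hg : Partrec₂ g) : Partrec₂ fun a => join f (g a) := by
  have hd : Computable fun z : α × ℕ => z.2 / 2 :=
    (Primrec.nat_div.comp Primrec.snd (Primrec.const 2)).to_comp
  have hm : Computable fun z : α × ℕ => decide (z.2 % 2 = 0) :=
    (Primrec.eq.comp (Primrec.nat_mod.comp Primrec.snd (Primrec.const 2))
      (Primrec.const 0)).decide.to_comp
  refine (Partrec.cond hm ((Partrec.nat_iff.2 hf).comp hd)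
    (hg.comp Computable.fst hd)).of_eq fun z => ?_
  by_cases hn : z.2 % 2 = 0 <;> simp [join, hn]

/-- The index `f 0` does not depend on the parameter, so a single program serves the whole family.
-/
theorem oostenApp_partrec₂ {α : Type*} [Primcodable α] {f : ℕ →. ℕ} {g : α → ℕ →. ℕ}
    (hf : Nat.Partrec f) (hg : Partrec₂ g) : Partrec₂ fun a => oostenApp f (g a) := by
  rcases Part.eq_none_or_eq_some (f 0) with h | ⟨e, h⟩
  · exact Partrec.none.of_eq fun n => by simp [oostenApp, h]
  · exact (OracleCode.eval_partrec₂ (join_partrec₂ hf hg) (OracleCode.ofIndex e)).of_eq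
      fun n => by simp [oostenApp, h, Φ]

/-- The `s`-`m`-`n` theorem for families of partial functions indexed by programs. -/
theorem exists_computable_code {F : Code → ℕ →. ℕ} (hF : Partrec₂ F) :
    ∃ T : Code → Code, Computable T ∧ ∀ d, (T d).eval = F d := by
  have h : Partrec fun p : ℕ => F (Denumerable.ofNat Code p.unpair.1) p.unpair.2 :=
    hF.comp ((Computable.ofNat Code).comp (Computable.fst.comp Computable.unpair))
      (Computable.snd.comp Computable.unpair)
  obtain ⟨c, hc⟩ := Code.exists_code.1 (Partrec.nat_iff.1 h)
  refine ⟨fun d => c.curry (Encodable.encode d), Code.primrec₂_curry.to_comp.comp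
    (Computable.const c) Computable.encode, fun d => ?_⟩
  funext n
  simp [Code.eval_curry, hc]

/-- A sequence obtained by iterating application of a fixed element is uniformly computable. -/
theorem partrec₂_of_oostenApp_iterate {s : ℕ →. ℕ} (hs : Nat.Partrec s) {g : ℕ → ℕ →. ℕ}
    (h0 : Nat.Partrec (g 0)) (hg : ∀ n, g (n + 1) = oostenApp s (g n)) : Partrec₂ g := by
  -- `T` turns a program for `g n` into one for `g (n + 1)`; iterating it from a program for `g 0`
  -- gives programs computably in `n`.
  obtain ⟨T, hT, hTs⟩ := exists_computable_code (oostenApp_partrec₂ hs Code.eval_part)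
  obtain ⟨c, hc⟩ := Code.exists_code.1 h0
  have hcode : Computable fun n : ℕ => Nat.rec (motive := fun _ => Code) c (fun _ d => T d) n :=
    Computable.nat_rec Computable.id (Computable.const c)
      (hT.comp (Computable.snd.comp Computable.snd)).to₂
  refine (Code.eval_part.comp (hcode.comp Computable.fst) Computable.snd).of_eq fun z => ?_
  obtain ⟨n, x⟩ := z
  suffices h : (Nat.rec (motive := fun _ => Code) c (fun _ d => T d) n).eval = g n from
    congrFun h x
  induction n with
  | zero => exact hc
  | succ n ih => rw [hg, ← ih, ← hTs]

/-! ### Weak embeddings of the c.e. sets -/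

/-- The halting set. -/
def haltingSet : Set ℕ := {n | ((Denumerable.ofNat Code n).eval 0).Dom}

theorem isCE_haltingSet : IsCE haltingSet :=
  (Code.eval_part.comp (Computable.ofNat Code) (Computable.const 0)).dom_re

theorem not_isCE_compl_haltingSet : ¬ IsCE haltingSetᶜ := fun h =>
  ComputablePred.halting_problem_not_re 0 <| REPred.of_eq
    (p := fun c : Code => Encodable.encode c ∈ haltingSetᶜ)
    (Partrec.comp h Computable.encode) fun c => by simp [haltingSet]

/-- Run `g n` and diverge if the result differs from `y`; the domain of this is c.e. -/
theorem isCE_mem_of_partrec {g : ℕ →. ℕ} (hg : Partrec g) (y : ℕ) : IsCE {n | y ∈ g n} := by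
  have h : Partrec fun n => (g n).bind fun z => cond (decide (z = y)) (Part.some z) Part.none :=
    hg.bind (Partrec.cond
      (Primrec.eq.comp Primrec.snd (Primrec.const y)).decide.to_comp
      Computable.snd.partrec Partrec.none)
  refine REPred.of_eq h.dom_re fun n => ?_
  rw [Part.dom_iff_mem]
  constructor
  · rintro ⟨w, hw⟩
    obtain ⟨z, hz, hw⟩ := Part.mem_bind_iff.1 hw
    by_cases hzy : z = y
    · exact hzy ▸ hz
    · simp [hzy] at hw
  · exact fun hy => ⟨y, Part.mem_bind_iff.2 ⟨y, hy, by simp⟩⟩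

section Embedding

variable {f : ceSets.Carrier → oostenEff.Carrier}

theorem IsWeakEmbedding.eq_oostenApp (hf : IsWeakEmbedding ceSets oostenEff f)
    {X Y Z : Set ℕ} (hX : IsCE X) (hY : IsCE Y) (hZ : IsCE Z) (h : graphApp X Y = Z) :
    (f ⟨Z, hZ⟩).1 = oostenApp (f ⟨X, hX⟩).1 (f ⟨Y, hY⟩).1 := by
  subst h
  exact congrArg Subtype.val (Part.mem_some_iff.1
    (hf.2 ⟨X, hX⟩ ⟨Y, hY⟩ ⟨_, hZ⟩ (Part.mem_some _)))

theorem IsWeakEmbedding.partrec₂_singleton (hf : IsWeakEmbedding ceSets oostenEff f) :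
    Partrec₂ fun n => (f ⟨{n}, isCE_singleton n⟩).1 :=
  partrec₂_of_oostenApp_iterate (f ⟨_, isCE_successorGraph⟩).2 (f ⟨{0}, isCE_singleton 0⟩).2
    fun n => hf.eq_oostenApp _ _ _ (graphApp_successorGraph n)

/-- A weak embedding of the c.e. sets into the effective van Oosten model is monotone. -/
theorem IsWeakEmbedding.mono (hf : IsWeakEmbedding ceSets oostenEff f)
    {X Y : Set ℕ} (hX : IsCE X) (hY : IsCE Y) (hXY : X ⊆ Y) {m y : ℕ}
    (hy : y ∈ (f ⟨X, hX⟩).1 m) : y ∈ (f ⟨Y, hY⟩).1 m := by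
  by_contra hy'
  -- As `y` is a value of `f X` but not of `f Y` at `m`, testing `f Q · f {n}` at `m` for `y`
  -- detects exactly `n` outside the halting set.
  have hQ := isCE_haltingSet.switchGraph hX hY
  have hp := (oostenApp_partrec₂ (f ⟨_, hQ⟩).2 hf.partrec₂_singleton).comp Computable.id
    (Computable.const m)
  refine not_isCE_compl_haltingSet (REPred.of_eq (isCE_mem_of_partrec hp y) fun n => ?_)
  by_cases hn : n ∈ haltingSet
  · simpa [hn, ← hf.eq_oostenApp hQ (isCE_singleton n) hY
      (graphApp_switchGraph_of_mem hXY hn)] using hy'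
  · simpa [hn, ← hf.eq_oostenApp hQ (isCE_singleton n) hX
      (graphApp_switchGraph_of_notMem hn)] using hy

end Embedding

/-- Application in the van Oosten model is stable along ordered pairs of arguments. -/
theorem oostenApp_stable {f f' g g' : ℕ →. ℕ} (hf : ∀ m, ∀ y ∈ f m, y ∈ f' m)
    (hg : ∀ m, ∀ y ∈ g m, y ∈ g' m) {m y z : ℕ} (hy : y ∈ oostenApp f' g m)
    (hz : z ∈ oostenApp f g' m) : y ∈ oostenApp f g m := by
  obtain ⟨e', he', hy⟩ := Part.mem_bind_iff.1 hy
  obtain ⟨e, he, hz⟩ := Part.mem_bind_iff.1 hz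
  -- `f'` extends `f`, so both computations run the same program.
  obtain rfl := Part.mem_unique he' (hf _ _ he)
  refine Part.mem_bind_iff.2 ⟨e', he, (OracleCode.eval_stable ?_ _ _ _ _ hy hz).1⟩
  -- The oracles `f' ⊕ g` and `f ⊕ g'` agree where both are defined, and their common part lies in
  -- `f ⊕ g`: even queries are settled by `f`, odd ones by `g`.
  intro q a b ha hb
  unfold join at ha hb ⊢
  split_ifs at ha hb ⊢
  · obtain rfl := Part.mem_unique ha (hf _ _ hb)
    exact ⟨hb, rfl⟩
  · exact ⟨ha, Part.mem_unique (hg _ _ ha) hb⟩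

end PCA

/-- The combinatory algebra of c.e. sets does not weakly embed into the effective
van Oosten model. -/
theorem mainTheorem3 : ¬ PCA.WeaklyEmbeds PCA.ceSets PCA.oostenEff := by
  open PCA in
  rintro ⟨f, hf⟩
  have hP : IsCE parallelOr := isCE_pair _ _
  have h1 := hf.eq_oostenApp (isCE_pair (Nat.pair 0 0) (Nat.pair 0 1)) isCE_empty
    (isCE_singleton 0) graphApp_pair_zero_zero_empty
  have h2 := hf.eq_oostenApp (isCE_singleton (Nat.pair 0 1)) (isCE_singleton 0)
    (isCE_singleton 0) graphApp_pair_zero_one_zero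
  have h3 := hf.eq_oostenApp (isCE_singleton (Nat.pair 0 1)) isCE_empty
    isCE_empty graphApp_pair_zero_one_empty
  have hle : ∀ m, ∀ y ∈ (f ⟨{0}, isCE_singleton 0⟩).1 m, y ∈ (f ⟨∅, isCE_empty⟩).1 m := by
    intro m y hy
    rw [h3]
    -- The value `y` of `f {0}` is computed both with the larger function and smaller argument
    -- (`h1`) and with the smaller function and larger argument (`h2`).
    exact oostenApp_stable (fun _ _ => hf.mono _ (isCE_pair _ _) (by simp))
      (fun _ _ => hf.mono _ (isCE_singleton 0) (by simp)) (h1 ▸ hy) (h2 ▸ hy)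
  have heq : (⟨∅, isCE_empty⟩ : ceSets.Carrier) = ⟨{0}, isCE_singleton 0⟩ := by
    refine hf.1 (Subtype.ext (funext fun m => Part.ext fun y => ?_))
    exact ⟨hf.mono _ _ (Set.empty_subset _), hle m y⟩
  exact Set.singleton_ne_empty 0 (congrArg Subtype.val heq).symm
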